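/- A quasi-metric space is a set $X$ with a function $d:X\times X\to[0,\infty)$ (not necessarily symmetric) such that $d(x,x)=0$, $d(x,z)\le d(x,y)+d(y,z)$, and $d(x,y)>0$ whenever $x\ne y$. Notation. Let $\mathbf A$ be the category of $\mathbb R$-graded abelian groups and let $\mathrm{Ch}_{\mathbf A}$ be the category of non-negatively graded chain complexes in $\mathbf A$. For $\ell\ge 0$ let $\Sigma(\ell)\in\mathbf A$ be $\mathbb Z$ in grading $\ell$ and $0$ in every other grading; this is a functor on $[0,\infty)$ (with a morphism $\ell\to m$ exactly when $\ell\ge m$), strong monoidal from $+$ to the convolution tensor product of $\mathbf A$. For $X$ with distance $d$, the magnitude nerve $B_\bullet(\Sigma X,\mathbb 1)$ is the simplicial object of $\mathbf A$ with $$B_n(\Sigma X,\mathbb 1)=\coprod_{x_0,\dots,x_n\in X}B_{x_0,\dots,x_n},\qquad B_{x_0,\dots,x_n}=\Sigma(d(x_0,x_1))\otimes\cdots\otimes\Sigma(d(x_{n-1},x_n))\otimes\Sigma(0)\cong\Sigma\big(d(x_0,x_1)+\cdots+d(x_{n-1},x_n)\big),$$ whose degeneracies repeat a point, and whose faces discard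 a point when this does not change the total length and are $0$ otherwise. The realized magnitude nerve $B(\Sigma X,\mathbb 1)\in\mathrm{Ch}_{\mathbf A}$ is its geometric realization, i.e. its normalized chain complex $n\mapsto B_n/L_nB$, where $L_nB$ is the latching object (the colimit over all degeneracies into $B_n$). Let $L_{x_0,\dots,x_n}B$ be the colimit of the summands of the sources of all proper degeneracy maps that map into the summand $B_{x_0,\dots,x_n}$. A complex $C\in\mathrm{Ch}_{\mathbf A}$ is Hahn finite if in each grading $\ell\in\mathbb R$ the complex $C_\ell$ is quasi-isomorphic to a bounded complex of finitely generated free abelian groups and the set of $\ell$ with $\chi(C)_\ell:=\sum_n(-1)^n\,\mathrm{rk}\,H_n(C_\ell)\ne0$ is well-ordered; then $\chi(C)=\sum_\ell\chi(C)_\ell\,q^\ell$ is an element of the Hahn series field $\mathbb Q((q^{\mathbb R}))$, which carries the topology of the valuation given by the smallest exponent with non-zero coefficient. Graded abelian groups are regarded as complexes concentrated in degree $0$, and the weight of a tuple is $$w(x_0,\dots,x_n)=\chi(B_{x_0,\dots,x_n})-\chi(L_{x_0,\dots,x_n}B).$$ Theorem. Every finite quasi-metric space $X$ has convergent magnitude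 Euler characteristic with respect to $\chi$. That is, all $B_{x_0,\dots,x_n}$ and $L_{x_0,\dots,x_n}B$ are Hahn finite (so that the weights are defined), and: 1. $B(\Sigma X,\mathbb 1)$ is Hahn finite. 2. For all $a,b\in X$ the series $\displaystyle\sum_{n=0}^\infty(-1)^n\sum_{x_0=a,\;x_1,\dots,x_{n-1}\in X,\;x_n=b}w(x_0,\dots,x_n)$ converges in $\mathbb Q((q^{\mathbb R}))$. 3. The series $\displaystyle\sum_{n=0}^\infty(-1)^n\sum_{x_0,\dots,x_n\in X}w(x_0,\dots,x_n)$ converges in $\mathbb Q((q^{\mathbb R}))$ to $\chi(B(\Sigma X,\mathbb 1))$. -/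

import Mathlib

open CategoryTheory Limits Opposite Filter Topology
open scoped NNReal

universe u

namespace MagnitudeHomology

/-! ### Quasi-metric spaces -/

/-- A (small) category enriched over `[0,∞)` with the opposite ordering and monoidal structure `+`,
i.e. a quasi-pseudo-metric space. Symmetry of `d` is not required. -/
class QuasiPseudoMetric (X : Type u) where
  /-- the distance, i.e. the hom-object from `x` to `y` -/
  d : X → X → ℝ≥0
  d_self : ∀ x, d x x = 0
  d_triangle : ∀ x y z, d x z ≤ d x y + d y z

open QuasiPseudoMetric

/-- A quasi-metric space: distinct points are at positive distance. -/
def IsQuasiMetric (X : Type u) [QuasiPseudoMetric X] : Prop :=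
  ∀ x y : X, x ≠ y → 0 < d x y

/-! ### Latching objects, fibrewise coproducts, normalized chains -/

section General

variable {E : Type*} [Category E] {A : Type*} [Category A]

/-- For a category `E` over `Δᵒᵖ`, the category of proper degeneracy maps into the object `e`: maps
`e' ⟶ e` lying over a non-identity surjection `[n] ↠ [k]`, `k < n`, with their maps over `e`. -/
def properDegeneracy (p : E ⥤ SimplexCategoryᵒᵖ) (e : E) : ObjectProperty (Over e) := fun f =>
  Epi (p.map f.hom).unop ∧ (p.obj f.left).unop.len < (p.obj e).unop.len

/-- The diagram of the values of `F` at the sources of all proper degeneracy maps into `e`. -/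
def latchingDiagram (p : E ⥤ SimplexCategoryᵒᵖ) (F : E ⥤ A) (e : E) :
    (properDegeneracy p e).FullSubcategory ⥤ A :=
  (properDegeneracy p e).ι ⋙ Over.forget e ⋙ F

/-- The latching object of `F` at `e`: the colimit over all proper degeneracy maps into `e`. -/
noncomputable def latchingObj (p : E ⥤ SimplexCategoryᵒᵖ) (F : E ⥤ A) (e : E)
    [HasColimit (latchingDiagram p F e)] : A :=
  colimit (latchingDiagram p F e)

/-- The canonical cocone over the latching diagram, with vertex `F e`. -/
def latchingCocone (p : E ⥤ SimplexCategoryᵒᵖ) (F : E ⥤ A) (e : E) :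
    Cocone (latchingDiagram p F e) where
  pt := F.obj e
  ι :=
    { app := fun f => F.map f.obj.hom
      naturality := fun f g φ => by
        dsimp [latchingDiagram]
        rw [Category.comp_id, ← F.map_comp, Over.w] }

/-- The latching map from the latching object of `F` at `e` to `F e`. -/
noncomputable def latchingMap (p : E ⥤ SimplexCategoryᵒᵖ) (F : E ⥤ A) (e : E)
    [HasColimit (latchingDiagram p F e)] : latchingObj p F e ⟶ F.obj e :=
  colimit.desc _ (latchingCocone p F e)

/-- The canonical map into the latching object from the source of a proper degeneracy map. -/
noncomputable def latchingι (p : E ⥤ SimplexCategoryᵒᵖ) (F : E ⥤ A) (e : E)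
    [HasColimit (latchingDiagram p F e)] (f : Over e) (hf : properDegeneracy p e f) :
    F.obj f.left ⟶ latchingObj p F e :=
  colimit.ι (latchingDiagram p F e) ⟨f, hf⟩

lemma latchingι_comp_map (p : E ⥤ SimplexCategoryᵒᵖ) (F : E ⥤ A) (e : E)
    [HasColimit (latchingDiagram p F e)] (f : Over e) (hf : properDegeneracy p e f) :
    latchingι p F e f hf ≫ latchingMap p F e = F.map f.hom :=
  colimit.ι_desc (latchingCocone p F e) ⟨f, hf⟩

lemma latchingObj_hom_ext (p : E ⥤ SimplexCategoryᵒᵖ) (F : E ⥤ A) (e : E)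
    [HasColimit (latchingDiagram p F e)] {T : A} {g h : latchingObj p F e ⟶ T}
    (H : ∀ f hf, latchingι p F e f hf ≫ g = latchingι p F e f hf ≫ h) : g = h :=
  colimit.hom_ext fun f => H f.obj f.property

lemma map_comp_sigma_ι (S : SSet.{u}) [HasCoproducts.{u} A] (F : S.Elements ⥤ A)
    {m : SimplexCategoryᵒᵖ} {y y' : S.obj m} (h : y = y') {e : S.Elements}
    (φ : e ⟶ S.elementsMk m y) (ψ : e ⟶ S.elementsMk m y') (hv : φ.val = ψ.val) :
    F.map φ ≫ Limits.Sigma.ι (fun z : S.obj m => F.obj (S.elementsMk m z)) y =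
      F.map ψ ≫ Limits.Sigma.ι (fun z : S.obj m => F.obj (S.elementsMk m z)) y' := by
  subst h
  have h' : φ = ψ := CategoryOfElements.ext _ _ _ hv
  rw [h']

/-- Left Kan extension of a functor on the category of simplices `(Δᵒᵖ ↓ S)` of a simplicial set
`S` along the projection to `Δᵒᵖ` (a discrete opfibration): `n ↦ ∐_{x ∈ S_n} F(x)`. -/
noncomputable def fibrewiseCoproduct (S : SSet.{u}) [HasCoproducts.{u} A] (F : S.Elements ⥤ A) :
    SimplicialObject A where
  obj n := ∐ fun x : S.obj n => F.obj (S.elementsMk n x)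
  map {n m} f := Limits.Sigma.desc fun x =>
    F.map (CategoryOfElements.homMk (S.elementsMk n x) (S.elementsMk m (S.map f x)) f rfl) ≫
      Limits.Sigma.ι (fun y : S.obj m => F.obj (S.elementsMk m y)) (S.map f x)
  map_id n := by
    refine Limits.Sigma.hom_ext _ _ fun x => ?_
    rw [Limits.Sigma.ι_desc, Category.comp_id]
    have hx : S.map (𝟙 n) x = x := by simp
    rw [map_comp_sigma_ι S F hx _ (𝟙 (S.elementsMk n x)) rfl, F.map_id, Category.id_comp]
  map_comp {n m k} f g := by
    refine Limits.Sigma.hom_ext _ _ fun x => ?_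
    have hx : S.map (f ≫ g) x = S.map g (S.map f x) := by simp
    rw [Limits.Sigma.ι_desc, Limits.Sigma.ι_desc_assoc, Category.assoc, Limits.Sigma.ι_desc,
      ← Category.assoc, ← F.map_comp]
    exact map_comp_sigma_ι S F hx _ _ rfl

end General

section Normalized

open AlgebraicTopology DoldKan

variable {A : Type*} [Category A] [Abelian A] [HasColimits A] (B : SimplicialObject A)

/-- The latching map `L_n B ⟶ B_n` of a simplicial object, the inclusion of the degenerate
`n`-simplices. -/
noncomputable abbrev simplicialLatchingMap (n : ℕ) :
    latchingObj (𝟭 _) B (op (SimplexCategory.mk n)) ⟶ B.obj (op (SimplexCategory.mk n)) :=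
  latchingMap (𝟭 _) B (op (SimplexCategory.mk n))

lemma degeneraciesVanish_cokernel_π (n : ℕ) :
    DegeneraciesVanish (cokernel.π (simplicialLatchingMap B n)) := by
  cases n with
  | zero => trivial
  | succ n =>
    intro i
    have h := latchingι_comp_map (𝟭 SimplexCategoryᵒᵖ) B (op (SimplexCategory.mk (n + 1)))
      (Over.mk (SimplexCategory.σ i).op) ⟨by
        change Epi (SimplexCategory.σ i)
        infer_instance, Nat.lt_succ_self n⟩
    have h' : B.σ i = _ := h.symm
    rw [h']
    exact (Category.assoc _ _ _).trans (by rw [cokernel.condition, comp_zero])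

lemma latchingMap_comp_eq_zero {n : ℕ} {T : A} {g : B.obj (op (SimplexCategory.mk n)) ⟶ T}
    (hg : DegeneraciesVanish g) : simplicialLatchingMap B n ≫ g = 0 := by
  refine latchingObj_hom_ext _ _ _ fun f hf => ?_
  rw [comp_zero, ← Category.assoc, latchingι_comp_map]
  have hlt : f.left.unop.len < n := hf.2
  cases n with
  | zero => omega
  | succ n =>
    obtain ⟨i, θ, h⟩ := SimplexCategory.eq_σ_comp_of_not_injective f.hom.unop (fun hinj => by
      have hm : Mono f.hom.unop := SimplexCategory.mono_iff_injective.2 hinj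
      have := SimplexCategory.len_le_of_mono f.hom.unop
      change n + 1 ≤ _ at this
      change _ < n + 1 at hlt
      exact absurd hlt (not_lt.2 this))
    have h' : f.hom = θ.op ≫ (SimplexCategory.σ i).op := by
      rw [← op_comp, ← h]; rfl
    have h0 : B.map (SimplexCategory.σ i).op ≫ g = 0 := hg i
    rw [h', B.map_comp, Category.assoc, h0, comp_zero]

/-- The normalized boundary `B_{n+1} / L_{n+1} B ⟶ B_n / L_n B`, induced by the alternating sum of
the face maps. -/
noncomputable def normalizedD (n : ℕ) :
    cokernel (simplicialLatchingMap B (n + 1)) ⟶ cokernel (simplicialLatchingMap B n) :=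
  cokernel.desc _ (AlternatingFaceMapComplex.objD B n ≫ cokernel.π _) (by
    apply latchingMap_comp_eq_zero
    rw [degeneraciesVanish_iff_QInfty_f_comp]
    have h := (QInfty (X := B)).comm (n + 1) n
    have h0 := (degeneraciesVanish_iff_QInfty_f_comp _).1 (degeneraciesVanish_cokernel_π B n)
    have hd : (AlternatingFaceMapComplex.obj B).d (n + 1) n =
      AlternatingFaceMapComplex.objD B n := AlternatingFaceMapComplex.obj_d_eq B n
    rw [← hd]
    refine (Category.assoc _ _ _).symm.trans ?_
    rw [h]
    exact (Category.assoc _ _ _).trans (by rw [h0, comp_zero]))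

lemma cokernel_π_comp_normalizedD (n : ℕ) :
    cokernel.π (simplicialLatchingMap B (n + 1)) ≫ normalizedD B n =
      AlternatingFaceMapComplex.objD B n ≫ cokernel.π (simplicialLatchingMap B n) :=
  cokernel.π_desc _ _ _

/-- The normalized chain complex of a simplicial object, `(N B)_n = B_n / L_n B`, which is the
object of `Ch_A` that corresponds to `B` under the Dold-Kan equivalence. -/
noncomputable def normalizedComplex : ChainComplex A ℕ :=
  ChainComplex.of (fun n => cokernel (simplicialLatchingMap B n)) (normalizedD B) fun n => by
    rw [← cancel_epi (cokernel.π (simplicialLatchingMap B (n + 2))), ← Category.assoc,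
      cokernel_π_comp_normalizedD, Category.assoc, cokernel_π_comp_normalizedD, ← Category.assoc,
      AlternatingFaceMapComplex.d_squared, zero_comp, comp_zero]

end Normalized

/-! ### The magnitude nerve of a quasi-pseudo-metric space -/

section Nerve

/-- The functor `Σ` from `[0,∞)` (with a morphism `ℓ ⟶ m` exactly when `ℓ ≥ m`) to `ℝ`-graded
abelian groups: `Σ(ℓ)` is `ℤ` in grading `ℓ` and `0` in all other gradings. Since
`Hom(Σ(ℓ), Σ(m)) = 0` for `ℓ ≠ m`, non-identity morphisms are sent to `0`. -/
noncomputable def stabilization : ℝ≥0ᵒᵖ ⥤ GradedObject ℝ (ModuleCat.{u} ℤ) where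
  obj ℓ := fun k => open Classical in
    if (ℓ.unop : ℝ) = k then ModuleCat.of ℤ (ULift.{u} ℤ) else ModuleCat.of ℤ PUnit.{u + 1}
  map {ℓ m} _ := fun _ => open Classical in if h : ℓ = m then eqToHom (by rw [h]) else 0
  map_id ℓ := by
    funext k
    simp
  map_comp {a b c} f g := by
    funext k
    by_cases hab : a = b
    · subst hab
      by_cases hac : a = c
      · subst hac
        simp
      · simp [hac]
    · have hac : a ≠ c := fun hac => hab (by
        subst hac
        exact Opposite.unop_injective (le_antisymm g.unop.le f.unop.le))
      simp [hab, hac]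

variable (X : Type u)

/-- The nerve of the chaotic (indiscrete) groupoid on the set `X`: its `n`-simplices are the tuples
`(x_0, …, x_n)` of elements of `X`. -/
def chaoticNerve : SSet.{u} where
  obj n := Fin (n.unop.len + 1) → X
  map f := ↾ fun x => x ∘ f.unop.toOrderHom

variable {X} [QuasiPseudoMetric X]

/-- The total length `d(x_0,x_1) + ⋯ + d(x_{n-1},x_n)` of a tuple, i.e. the tensor product
`X(x_0,x_1) ⊗ ⋯ ⊗ X(x_{n-1},x_n) ⊗ 1` in `[0,∞)`. -/
noncomputable def length {n : ℕ} (x : Fin (n + 1) → X) : ℝ≥0 :=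
  ∑ i : Fin n, d (x i.castSucc) (x i.succ)

lemma d_le_sum_Ico (y : ℕ → X) {a b : ℕ} (h : a ≤ b) :
    d (y a) (y b) ≤ ∑ i ∈ Finset.Ico a b, d (y i) (y (i + 1)) := by
  induction b, h using Nat.le_induction with
  | base => simp [d_self]
  | succ b hab ih =>
    rw [Finset.sum_Ico_succ_top hab]
    exact (d_triangle _ (y b) _).trans (by gcongr)

lemma sum_le_sum_Ico (y : ℕ → X) (a : ℕ → ℕ) (ha : Monotone a) (m : ℕ) :
    ∑ i ∈ Finset.range m, d (y (a i)) (y (a (i + 1))) ≤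
      ∑ i ∈ Finset.Ico (a 0) (a m), d (y i) (y (i + 1)) := by
  induction m with
  | zero => simp
  | succ m ih =>
    rw [Finset.sum_range_succ, ← Finset.sum_Ico_consecutive _ (ha (Nat.zero_le m))
      (ha (Nat.le_succ m))]
    exact add_le_add ih (d_le_sum_Ico y (ha (Nat.le_succ m)))

/-- Composition of morphisms: lengths do not increase along a simplicial operator. -/
lemma length_comp_le {m n : ℕ} (x : Fin (n + 1) → X) (α : Fin (m + 1) →o Fin (n + 1)) :
    length (x ∘ α) ≤ length x := by
  let y : ℕ → X := fun i => x (Fin.ofNat (n + 1) (min i n))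
  let a : ℕ → ℕ := fun i => (α (Fin.ofNat (m + 1) (min i m)) : ℕ)
  have hmin : ∀ (k i : ℕ), (Fin.ofNat (k + 1) (min i k) : ℕ) = min i k := fun k i => by
    simp [Fin.ofNat]
  have ha : Monotone a := fun i j hij => by
    refine α.monotone (Fin.le_def.2 ?_)
    rw [hmin, hmin]
    omega
  have hy : ∀ i : Fin (n + 1), y i = x i := fun i => by
    change x _ = x i
    congr 1
    ext
    rw [hmin]
    omega
  have hα : ∀ (i : Fin (m + 1)), a i = α i := fun i => by
    change ((α _ : Fin (n + 1)) : ℕ) = α i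
    congr 2
    ext
    rw [hmin]
    omega
  have h1 : length (x ∘ α) = ∑ i ∈ Finset.range m, d (y (a i)) (y (a (i + 1))) := by
    rw [Finset.sum_range, length]
    refine Finset.sum_congr rfl fun i _ => ?_
    have e1 := hα i.castSucc
    have e2 := hα i.succ
    simp only [Fin.val_castSucc, Fin.val_succ] at e1 e2
    rw [e1, e2, hy, hy]
    rfl
  have h2 : length x = ∑ i ∈ Finset.range n, d (y i) (y (i + 1)) := by
    rw [Finset.sum_range, length]
    refine Finset.sum_congr rfl fun i _ => ?_
    have e1 := hy i.castSucc
    have e2 := hy i.succ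
    simp only [Fin.val_castSucc, Fin.val_succ] at e1 e2
    rw [e1, e2]
  rw [h1, h2]
  refine (sum_le_sum_Ico y a ha m).trans (Finset.sum_le_sum_of_subset fun i hi => ?_)
  have hm : a m ≤ n := Nat.lt_succ_iff.1 (α _).2
  rw [Finset.mem_Ico] at hi
  exact Finset.mem_range.2 (hi.2.trans_le hm)

variable (X)

/-- The length of a tuple, as a functor from the category of simplices `(Δᵒᵖ ↓ X_ch)` of the chaotic
nerve to `[0,∞)`. On inner faces it is the composition of `X`, on outer faces the unique map to the
unit object `0`, on degeneracies the identities of `X`. -/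
noncomputable def lengthFunctor : (chaoticNerve X).Elements ⥤ ℝ≥0ᵒᵖ where
  obj e := op (length (X := X) (n := e.1.unop.len) e.2)
  map {e e'} f := (homOfLE (by
    obtain ⟨f, hf⟩ := f
    rw [← hf]
    exact length_comp_le (X := X) (n := e.1.unop.len) (m := e'.1.unop.len) e.2
      f.unop.toOrderHom)).op

/-- The summands of the simplicial bar construction,
`B_{x_0,…,x_n}(ΣX, 𝟙) = ΣX(x_0,x_1) ⊗ ⋯ ⊗ ΣX(x_{n-1},x_n) ⊗ 𝟙(x_n,x_0)`
`= Σ(X(x_0,x_1) ⊗ ⋯ ⊗ X(x_{n-1},x_n) ⊗ 1)`,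
as a functor of the tuple `(x_0,…,x_n)`; here `⊗` of graded groups is convolution, for which `Σ` is
strong monoidal. -/
noncomputable def barSummand : (chaoticNerve X).Elements ⥤ GradedObject ℝ (ModuleCat.{u} ℤ) :=
  lengthFunctor X ⋙ stabilization

/-- The magnitude nerve `B_•(ΣX, 𝟙)`, a simplicial `ℝ`-graded abelian group, with
`B_n = ∐_{x_0,…,x_n} B_{x_0,…,x_n}(ΣX, 𝟙)`; it is written grading by grading. -/
noncomputable def magnitudeNerve : GradedObject ℝ (SimplicialObject (ModuleCat.{u} ℤ)) := fun ℓ =>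
  fibrewiseCoproduct (chaoticNerve X) (barSummand X ⋙ GradedObject.eval ℓ)

/-- The realized magnitude nerve `B(ΣX, 𝟙) = |B_•(ΣX, 𝟙)|`. For a simplicial object of an abelian
category, regarded as a simplicial object of (chain complexes concentrated in degree `0`), the
geometric realization is the object itself, that is, its normalized chain complex. -/
noncomputable def realizedMagnitudeNerve :
    GradedObject ℝ (ChainComplex (ModuleCat.{u} ℤ) ℕ) := fun ℓ =>
  normalizedComplex (magnitudeNerve X ℓ)

end Nerve

/-! ### The Hahn-series Euler characteristic -/

section Euler

/-- Finite complexes of abelian groups: those quasi-isomorphic to a bounded complex of finitely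
generated free abelian groups. A bounded complex of free groups is cofibrant, so that a single
quasi-isomorphism suffices. -/
def IsFiniteComplex (C : ChainComplex (ModuleCat.{u} ℤ) ℕ) : Prop :=
  ∃ (F : ChainComplex (ModuleCat.{u} ℤ) ℕ) (f : F ⟶ C),
    (∀ n, Module.Free ℤ (F.X n) ∧ Module.Finite ℤ (F.X n)) ∧
    (∃ N, ∀ n, N ≤ n → IsZero (F.X n)) ∧ QuasiIso f

/-- An `ℝ`-graded chain complex is Hahn finite if it is finite in every grading and if the support
of its graded Euler characteristic `ℓ ↦ ∑_n (-1)^n rk H_n(C_ℓ)` is well-ordered. -/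
structure IsHahnFinite (C : GradedObject ℝ (ChainComplex (ModuleCat.{u} ℤ) ℕ)) : Prop where
  finite : ∀ ℓ, IsFiniteComplex (C ℓ)
  wellOrdered : (Function.support fun ℓ => ((C ℓ).homologyEulerChar : ℚ)).IsPWO

/-- The Euler characteristic `χ` of Hahn finite graded chain complexes, with values in the field
`ℚ((q^ℝ))` of Hahn series. It is a partial function; the value is `0` outside its domain. -/
noncomputable def hahnEulerChar (C : GradedObject ℝ (ChainComplex (ModuleCat.{u} ℤ) ℕ)) :
    HahnSeries ℝ ℚ :=
  open Classical in
  if h : IsHahnFinite C then ⟨fun ℓ => ((C ℓ).homologyEulerChar : ℚ), h.wellOrdered⟩ else 0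

/-- A graded abelian group as a graded chain complex concentrated in degree `0`. -/
noncomputable def inDegreeZero (M : GradedObject ℝ (ModuleCat.{u} ℤ)) :
    GradedObject ℝ (ChainComplex (ModuleCat.{u} ℤ) ℕ) := fun ℓ =>
  (ChainComplex.single₀ (ModuleCat.{u} ℤ)).obj (M ℓ)

/-- The valuation topology on `ℚ((q^ℝ))`: the balls `{b | v(b - a) > r}` are a base. -/
instance hahnTopology : TopologicalSpace (HahnSeries ℝ ℚ) :=
  TopologicalSpace.generateFrom
    {U | ∃ (a : HahnSeries ℝ ℚ) (r : ℝ), U = {b | (r : WithTop ℝ) < HahnSeries.addVal ℝ ℚ (b - a)}}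

end Euler

/-! ### Weights and convergent magnitude Euler characteristic -/

section Weights

variable (X : Type u) [QuasiPseudoMetric X]

variable {X} in
/-- The tuple `(x_0,…,x_n)` as an object of the category of simplices of the chaotic nerve. -/
def tuple {n : ℕ} (x : Fin (n + 1) → X) : (chaoticNerve X).Elements :=
  (chaoticNerve X).elementsMk (op (SimplexCategory.mk n)) x

variable {X} in
/-- `B_{x_0,…,x_n}(ΣX, 𝟙)`, in degree `0`. -/
noncomputable def tupleObj {n : ℕ} (x : Fin (n + 1) → X) :
    GradedObject ℝ (ChainComplex (ModuleCat.{u} ℤ) ℕ) :=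
  inDegreeZero ((barSummand X).obj (tuple x))

variable {X} in
/-- `L_{x_0,…,x_n} B(ΣX, 𝟙)`, in degree `0`: the colimit, computed grading by grading, of the
summands in the sources of all proper degeneracy maps into the summand of `(x_0,…,x_n)`. -/
noncomputable def tupleLatching {n : ℕ} (x : Fin (n + 1) → X) :
    GradedObject ℝ (ChainComplex (ModuleCat.{u} ℤ) ℕ) :=
  inDegreeZero fun ℓ => latchingObj (CategoryOfElements.π (chaoticNerve X))
    (barSummand X ⋙ GradedObject.eval ℓ) (tuple x)

variable {X} in
/-- The weight `χ(B_{x_0,…,x_n}(ΣX, 𝟙)) - χ(L_{x_0,…,x_n} B(ΣX, 𝟙))` of a tuple. -/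
noncomputable def weight {n : ℕ} (x : Fin (n + 1) → X) : HahnSeries ℝ ℚ :=
  hahnEulerChar (tupleObj x) - hahnEulerChar (tupleLatching x)

/-- A finite quasi-pseudo-metric space has convergent magnitude Euler characteristic (with respect
to the Hahn-series Euler characteristic). The first two fields say that all weights are defined. -/
structure HasConvergentMagnitudeEulerChar [Fintype X] : Prop where
  finite_tupleObj : ∀ (n : ℕ) (x : Fin (n + 1) → X), IsHahnFinite (tupleObj x)
  finite_tupleLatching : ∀ (n : ℕ) (x : Fin (n + 1) → X), IsHahnFinite (tupleLatching x)
  finite_realizedNerve : IsHahnFinite (realizedMagnitudeNerve X)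
  converges : ∀ a b : X, ∃ s : HahnSeries ℝ ℚ, Tendsto
    (fun N : ℕ => ∑ n ∈ Finset.range N, (-1) ^ n *
      open Classical in
      ∑ x : Fin (n + 1) → X with x 0 = a ∧ x (Fin.last n) = b, weight x)
    atTop (𝓝 s)
  converges_to : Tendsto
    (fun N : ℕ => ∑ n ∈ Finset.range N, (-1) ^ n *
      open Classical in ∑ x : Fin (n + 1) → X, weight x)
    atTop (𝓝 (hahnEulerChar (realizedMagnitudeNerve X)))

end Weights

end MagnitudeHomology

/-! A degeneracy repeats a point, and since `d x x = 0` it preserves length; hence `barSummand`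
turns degeneracies into isomorphisms (`invertsDegeneracies_barSummand`). At a degenerate tuple, the
Eilenberg–Zilber lemma provides a nondegenerate root mapping to every object of the latching
diagram, so the latching map is an isomorphism (`isIso_latchingMap`). At a nondegenerate tuple the
diagram is empty. Hence `weight x` is `q ^ length x` for nondegenerate `x` and `0` otherwise
(`weight_eq`).

For the same reason, dividing by the latching object removes exactly the degenerate summands
(`cokernelLatchingIso`): in grading `ℓ` the `n`-chains are free on the nondegenerate tuples of
length `ℓ`, and their rank is the coefficient of `q ^ ℓ` in the sum of the weights of all `(n +
1)`-tuples (`finrank_realizedNerve_X`).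

Consecutive points of a nondegenerate tuple differ. As `X` is finite, distances between distinct
points are at least some `δ > 0`, so such a tuple has length at least `n * δ` (`exists_lt_length`).
Below any bound on exponents only finitely many `n` contribute. This gives convergence of the series
and boundedness of the complex in each grading, and Euler–Poincaré identifies the total sum with
`χ`. -/

namespace MagnitudeHomology

open QuasiPseudoMetric Simplicial

/-! ### Series in the valuation topology of the Hahn field -/

section Convergence

/-- Agreement of coefficients up to `r` means that the difference has valuation above `r`; by the
ultrametric inequality every ball containing `s` then contains `f N`. -/
lemma tendsto_hahnSeries {f : ℕ → HahnSeries ℝ ℚ} {s : HahnSeries ℝ ℚ}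
    (h : ∀ r : ℝ, ∀ᶠ N in atTop, ∀ k ≤ r, (f N).coeff k = s.coeff k) :
    Tendsto f atTop (𝓝 s) := by
  refine TopologicalSpace.tendsto_nhds_generateFrom_iff.2 ?_
  rintro _ ⟨a, r, rfl⟩ hs
  filter_upwards [h r] with N hN
  have h1 : (r : WithTop ℝ) < HahnSeries.addVal ℝ ℚ (f N - s) := by
    rw [HahnSeries.addVal_apply]
    by_contra hlt
    obtain ⟨k, hk, hne⟩ : ∃ k : ℝ, k ≤ r ∧ (f N - s).coeff k ≠ 0 := by
      have hne : f N - s ≠ 0 := fun h0 => hlt (by simp [h0])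
      -- The leading exponent is the offending `k`.
      refine ⟨(f N - s).order, ?_, mt HahnSeries.coeff_order_eq_zero.1 hne⟩
      rw [← HahnSeries.order_eq_orderTop_of_ne_zero hne, not_lt] at hlt
      exact_mod_cast hlt
    exact hne (by rw [HahnSeries.coeff_sub, hN k hk, sub_self])
  have h2 : f N - a = (f N - s) + (s - a) := by abel
  show (r : WithTop ℝ) < HahnSeries.addVal ℝ ℚ (f N - a)
  rw [h2]
  exact lt_of_lt_of_le (lt_min h1 hs) (AddValuation.map_add _ _ _)

/-- A strictly descending sequence would have infinitely many values, all below its first term. -/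
lemma isPWO_of_finite_Iic {s : Set ℝ} (h : ∀ r, (s ∩ Set.Iic r).Finite) : s.IsPWO := by
  rw [Set.isPWO_iff_isWF, Set.isWF_iff_no_descending_seq]
  intro f hf hs
  refine Set.infinite_range_of_injective hf.injective ((h (f 0)).subset ?_)
  rintro _ ⟨n, rfl⟩
  exact ⟨hs n, hf.antitone (Nat.zero_le n)⟩

/-- Up to `r` the sum is a finite one, so its support there lies in a finite union of finite sets.
The coefficients of the limit are recorded so that it can later be recognised as an Euler
characteristic. -/
lemma exists_tendsto_sum_hahnSeries {f : ℕ → HahnSeries ℝ ℚ}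
    (h : ∀ r : ℝ, ∃ N, ∀ n, N ≤ n → ∀ k ≤ r, (f n).coeff k = 0)
    (hfin : ∀ n, (f n).support.Finite) :
    ∃ s : HahnSeries ℝ ℚ, (∀ k, s.coeff k = ∑ᶠ n, (f n).coeff k) ∧
      Tendsto (fun N => ∑ n ∈ Finset.range N, f n) atTop (𝓝 s) := by
  choose N hN using h
  have hsum : ∀ r, ∀ k ≤ r, ∀ M, N r ≤ M →
      ∑ᶠ n, (f n).coeff k = ∑ n ∈ Finset.range M, (f n).coeff k := by
    intro r k hk M hM
    refine finsum_eq_sum_of_support_subset _ fun n hn => ?_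
    by_contra hlt
    exact hn (hN r n (hM.trans (by simpa using hlt)) k hk)
  refine ⟨⟨fun k => ∑ᶠ n, (f n).coeff k, isPWO_of_finite_Iic fun r => ?_⟩, fun _ => rfl,
    tendsto_hahnSeries fun r => ?_⟩
  · refine ((Finset.range (N r)).finite_toSet.biUnion fun n _ => hfin n).subset ?_
    rintro k ⟨hk, hkr⟩
    rw [Function.mem_support, hsum r k hkr _ le_rfl] at hk
    obtain ⟨n, hn, hne⟩ := Finset.exists_ne_zero_of_sum_ne_zero hk
    exact Set.mem_biUnion (Finset.mem_coe.2 hn) hne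
  · filter_upwards [eventually_ge_atTop (N r)] with M hM k hk
    rw [HahnSeries.coeff_sum]
    exact (hsum r k hk M hM).symm

end Convergence

/-! ### The Euler–Poincaré formula -/

section EulerPoincare

variable {R : Type*} [CommRing R] [IsDomain R] [IsNoetherianRing R]

/-- Additivity of rank, used twice: for boundaries inside cycles and for cycles inside `S.X₂`. -/
lemma finrank_homology_add (S : ShortComplex (ModuleCat.{u} R)) [Module.Finite R S.X₂] :
    Module.finrank R S.homology + Module.finrank R (LinearMap.range S.f.hom) +
      Module.finrank R (LinearMap.range S.g.hom) = Module.finrank R S.X₂ := by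
  have h1 := Submodule.finrank_quotient_add_finrank (LinearMap.range S.moduleCatToCycles)
  have h2 : Module.finrank R S.homology =
      Module.finrank R (LinearMap.ker S.g.hom ⧸ LinearMap.range S.moduleCatToCycles) :=
    S.moduleCatHomologyIso.toLinearEquiv.finrank_eq
  have h3 : Module.finrank R (LinearMap.range S.moduleCatToCycles) =
      Module.finrank R (LinearMap.range S.f.hom) := by
    have h : S.f.hom = (LinearMap.ker S.g.hom).subtype ∘ₗ S.moduleCatToCycles := rfl
    rw [h, LinearMap.range_comp]
    exact (Submodule.equivMapOfInjective _ (Submodule.injective_subtype _) _).finrank_eq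
  have h4 := Submodule.finrank_quotient_add_finrank (LinearMap.ker S.g.hom)
  rw [S.g.hom.quotKerEquivRange.finrank_eq] at h4
  omega

/-- The Euler–Poincaré formula for bounded complexes of finitely generated abelian groups. -/
lemma homologyEulerChar_eq_sum (C : ChainComplex (ModuleCat.{u} R) ℕ)
    [∀ n, Module.Finite R (C.X n)] {N : ℕ} (hN : ∀ n, N ≤ n → Module.finrank R (C.X n) = 0) :
    C.homologyEulerChar = ∑ n ∈ Finset.range N, (-1) ^ n * (Module.finrank R (C.X n) : ℤ) := by
  let r : ℕ → ℕ := fun n => Module.finrank R (LinearMap.range (C.d (n + 1) n).hom)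
  have hsc (n : ℕ) : Module.finrank R (C.homology n) + r n +
      Module.finrank R (LinearMap.range (C.sc n).g.hom) = Module.finrank R (C.X n) := by
    have hf : Module.finrank R (LinearMap.range (C.sc n).f.hom) = r n := by
      -- The predecessor index equals `n + 1` only propositionally, so it is generalised before
      -- substitution.
      have h (j : ℕ) (hj : j = n + 1) :
          Module.finrank R (LinearMap.range (C.d j n).hom) = r n := by subst hj; rfl
      exact h _ (ChainComplex.prev ℕ n)
    rw [← hf]
    have : Module.Finite R (C.sc n).X₂ := inferInstanceAs (Module.Finite R (C.X n))
    exact finrank_homology_add (C.sc n)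
  have hzero : Module.finrank R (LinearMap.range (C.sc 0).g.hom) = 0 := by
    have h : (C.sc 0).g = 0 := C.shape _ _ (by simp)
    rw [h, ModuleCat.hom_zero, LinearMap.range_zero, finrank_bot]
  have hsucc (n : ℕ) : Module.finrank R (LinearMap.range (C.sc (n + 1)).g.hom) = r n := by
    have h (j : ℕ) (hj : j = n) :
        Module.finrank R (LinearMap.range (C.d (n + 1) j).hom) = r n := by subst hj; rfl
    exact h _ (ChainComplex.next_nat_succ n)
  have hle (n : ℕ) (hn : N ≤ n) : Module.finrank R (C.homology n) = 0 ∧ r n = 0 := by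
    have := hsc n
    have := hN n hn
    omega
  rw [HomologicalComplex.homologyEulerChar_eq_sum_finSet_of_finrankSupport_subset C
    (Finset.range N) fun n hn => by
      by_contra h
      exact hn (hle n (by simpa using h)).1]
  -- The boundary ranks telescope; truncation at `M` leaves only the rank of the differential from
  -- degree `M + 1`, which vanishes for `M = N`.
  have key (M : ℕ) :
      ∑ n ∈ Finset.range (M + 1), ((-1) ^ n * (Module.finrank R (C.homology n) : ℤ)) =
      ∑ n ∈ Finset.range (M + 1), ((-1) ^ n * (Module.finrank R (C.X n) : ℤ)) -
        (-1) ^ M * (r M : ℤ) := by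
    induction M with
    | zero =>
      have := hsc 0
      rw [hzero] at this
      simp
      omega
    | succ M ih =>
      have := hsc (M + 1)
      rw [hsucc] at this
      rw [Finset.sum_range_succ, ih, Finset.sum_range_succ _ (M + 1), ← this]
      push_cast
      ring
  have h := key N
  rw [Finset.sum_range_succ, Finset.sum_range_succ, (hle N le_rfl).1, (hle N le_rfl).2,
    hN N le_rfl] at h
  simpa using h

end EulerPoincare

/-! ### Latching objects and the Eilenberg–Zilber lemma -/

section Latching

variable {A : Type*} [Category A] (S : SSet.{u}) (F : S.Elements ⥤ A)

/-- The functor `F` inverts the morphisms of the category of simplices lying over surjections. -/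
def InvertsDegeneracies : Prop :=
  ∀ ⦃e e' : S.Elements⦄ (φ : e ⟶ e'), Epi φ.val.unop → IsIso (F.map φ)

variable {S F}

lemma isEmpty_properDegeneracy {n : ℕ} {x : S _⦋n⦌} (hx : x ∈ S.nonDegenerate n) :
    IsEmpty (properDegeneracy (CategoryOfElements.π S)
      (S.elementsMk (op ⦋n⦌) x)).FullSubcategory := by
  refine ⟨fun ⟨f, hf⟩ => hx ?_⟩
  exact ⟨f.left.1.unop.len, hf.2, f.hom.val.unop, f.left.2, f.hom.property⟩

/-- The latching object at a nondegenerate simplex is initial. -/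
noncomputable def latchingObjIsInitial {n : ℕ} {x : S _⦋n⦌} (hx : x ∈ S.nonDegenerate n)
    [HasColimit (latchingDiagram (CategoryOfElements.π S) F (S.elementsMk (op ⦋n⦌) x))] :
    IsInitial (latchingObj (CategoryOfElements.π S) F (S.elementsMk (op ⦋n⦌) x)) :=
  have := isEmpty_properDegeneracy hx
  IsInitial.ofUniqueHom (fun T => colimit.desc _
    ⟨T, ⟨fun f => isEmptyElim f, fun f => isEmptyElim f⟩⟩)
    fun _ _ => colimit.hom_ext fun f => isEmptyElim f

/-- The object is the nondegenerate root of `x`. Uniqueness of the Eilenberg–Zilber decomposition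
makes every proper degeneracy into `x` receive a map from it. -/
lemma exists_initial_properDegeneracy {n : ℕ} {x : S _⦋n⦌} (hx : x ∈ S.degenerate n) :
    ∃ f : Over (S.elementsMk (op ⦋n⦌) x), properDegeneracy (CategoryOfElements.π S) _ f ∧
      ∀ g, properDegeneracy (CategoryOfElements.π S) _ g →
        ∃ φ : f ⟶ g, Epi φ.left.val.unop := by
  obtain ⟨m, s, hs, y, rfl⟩ := S.exists_nonDegenerate x
  have hm : m < n := by
    refine lt_of_le_of_ne (SimplexCategory.len_le_of_epi s) ?_
    rintro rfl
    have : s = 𝟙 _ := SimplexCategory.eq_id_of_epi s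
    subst this
    exact y.2 (by simpa using hx)
  refine ⟨Over.mk (Y := S.elementsMk (op ⦋m⦌) y.1)
    (CategoryOfElements.homMk _ _ s.op rfl), ⟨hs, hm⟩, ?_⟩
  intro g hg
  let t : ⦋n⦌ ⟶ ⦋g.left.1.unop.len⦌ := g.hom.val.unop
  have ht : Epi t := hg.1
  let z : S _⦋g.left.1.unop.len⦌ := g.left.2
  have hz : S.map s.op y.1 = S.map t.op z := g.hom.property.symm
  -- The root `w` of the source of `g` is also a root of `x`, so `w = y` and `s = t ≫ r`; thus `r`
  -- supplies the required map.
  obtain ⟨k, r, hr, w, hw⟩ := S.exists_nonDegenerate z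
  have h : S.map s.op y.1 = S.map (t ≫ r).op w.1 := by
    refine hz.trans ((congrArg (S.map t.op) hw).trans ?_)
    simp
  have : Epi (t ≫ r) := epi_comp _ _
  obtain rfl := S.unique_nonDegenerate_dim _ s y rfl _ w h
  obtain rfl := S.unique_nonDegenerate_simplex _ s y rfl _ w h
  have hst := S.unique_nonDegenerate_map _ s y rfl _ y h
  refine ⟨Over.homMk (CategoryOfElements.homMk _ _ r.op hw.symm) ?_, hr⟩
  apply CategoryOfElements.ext
  exact congrArg Quiver.Hom.op hst.symm

/-- All values in the diagram are identified with the value at the root, which `F` also identifies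
with the value at `x`. -/
lemma isIso_latchingMap (hF : InvertsDegeneracies S F) {n : ℕ} {x : S _⦋n⦌}
    (hx : x ∈ S.degenerate n)
    [HasColimit (latchingDiagram (CategoryOfElements.π S) F (S.elementsMk (op ⦋n⦌) x))] :
    IsIso (latchingMap (CategoryOfElements.π S) F (S.elementsMk (op ⦋n⦌) x)) := by
  obtain ⟨f, hfp, hf⟩ := exists_initial_properDegeneracy hx
  have := hF f.hom hfp.1
  refine ⟨inv (F.map f.hom) ≫ latchingι _ F _ f hfp, ?_, ?_⟩
  · refine latchingObj_hom_ext _ _ _ fun g hg => ?_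
    obtain ⟨φ, hφ⟩ := hf g hg
    have := hF φ.left hφ
    have h1 : F.map φ.left ≫ latchingι _ F _ g hg = latchingι _ F _ f hfp :=
      colimit.w (latchingDiagram (CategoryOfElements.π S) F (S.elementsMk (op ⦋n⦌) x))
        (j' := ⟨f, hfp⟩) (j := ⟨g, hg⟩) ⟨φ⟩
    rw [Category.comp_id, ← Category.assoc, latchingι_comp_map, ← cancel_epi (F.map φ.left), h1,
      ← Category.assoc, ← F.map_comp, Over.w, IsIso.hom_inv_id_assoc]
  · rw [Category.assoc, latchingι_comp_map, IsIso.inv_hom_id]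

end Latching

/-! ### Normalized chains of a fibrewise coproduct -/

section Normalized

variable {A : Type*} [Category A] [HasCoproducts.{u} A] {S : SSet.{u}} (F : S.Elements ⥤ A)

/-- The summand of a fibrewise coproduct at a simplex. -/
noncomputable abbrev fibrewiseι {n : ℕ} (x : S _⦋n⦌) :
    F.obj (S.elementsMk (op ⦋n⦌) x) ⟶ (fibrewiseCoproduct S F).obj (op ⦋n⦌) :=
  Limits.Sigma.ι (fun z : S _⦋n⦌ => F.obj (S.elementsMk (op ⦋n⦌) z)) x

lemma fibrewise_hom_ext {n : ℕ} {T : A} {g h : (fibrewiseCoproduct S F).obj (op ⦋n⦌) ⟶ T}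
    (H : ∀ x : S _⦋n⦌, fibrewiseι F x ≫ g = fibrewiseι F x ≫ h) : g = h :=
  Limits.Sigma.hom_ext _ _ H

lemma fibrewiseι_comp_map {n m : ℕ} (f : ⦋m⦌ ⟶ ⦋n⦌) (x : S _⦋n⦌) :
    fibrewiseι F x ≫ (fibrewiseCoproduct S F).map f.op =
      F.map (CategoryOfElements.homMk (S.elementsMk _ x) (S.elementsMk _ (S.map f.op x)) f.op rfl) ≫
        fibrewiseι F (S.map f.op x) :=
  Limits.Sigma.ι_desc _ _

/-- The coproduct of the values of `F` at the nondegenerate `n`-simplices. -/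
noncomputable abbrev nonDegenerateCoproduct (n : ℕ) : A :=
  ∐ fun x : S.nonDegenerate n => F.obj (S.elementsMk (op ⦋n⦌) x.1)

variable [Abelian A]

open Classical in
/-- The projection of `∐_{x ∈ S_n} F(x)` onto the summands of the nondegenerate simplices. -/
noncomputable def toNonDegenerate (n : ℕ) :
    (fibrewiseCoproduct S F).obj (op ⦋n⦌) ⟶ nonDegenerateCoproduct F n :=
  Limits.Sigma.desc fun x => if h : x ∈ S.nonDegenerate n then
    Limits.Sigma.ι (fun x : S.nonDegenerate n => F.obj (S.elementsMk (op ⦋n⦌) x.1)) ⟨x, h⟩ else 0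

lemma fibrewiseι_toNonDegenerate {n : ℕ} (x : S.nonDegenerate n) :
    fibrewiseι F x.1 ≫ toNonDegenerate F n =
      Limits.Sigma.ι (fun x : S.nonDegenerate n => F.obj (S.elementsMk (op ⦋n⦌) x.1)) x :=
  (Limits.Sigma.ι_desc _ _).trans (dif_pos x.2)

lemma fibrewiseι_toNonDegenerate_eq_zero {n : ℕ} {x : S _⦋n⦌} (hx : x ∈ S.degenerate n) :
    fibrewiseι F x ≫ toNonDegenerate F n = 0 :=
  (Limits.Sigma.ι_desc _ _).trans (dif_neg fun h => h hx)

variable [HasColimits A]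

lemma latchingMap_comp_toNonDegenerate (n : ℕ) :
    simplicialLatchingMap (fibrewiseCoproduct S F) n ≫ toNonDegenerate F n = 0 := by
  refine latchingObj_hom_ext _ _ _ fun f hf => ?_
  rw [comp_zero, ← Category.assoc, latchingι_comp_map]
  let t : ⦋n⦌ ⟶ ⦋f.left.unop.len⦌ := f.hom.unop
  have h : (fibrewiseCoproduct S F).map t.op ≫ toNonDegenerate F n = 0 := by
    refine fibrewise_hom_ext F fun x => ?_
    rw [← Category.assoc, fibrewiseι_comp_map, Category.assoc,
      fibrewiseι_toNonDegenerate_eq_zero (n := n) F ⟨_, hf.2, t, x, rfl⟩, comp_zero, comp_zero]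
  exact h

variable {F}

/-- Since `F` inverts degeneracies, the summand at `S.map t.op z` is the full image of the summand
at `z`, so it lies in the image of the latching map. -/
lemma fibrewiseι_comp_eq_zero (hF : InvertsDegeneracies S F) {n : ℕ} {T : A}
    {g : (fibrewiseCoproduct S F).obj (op ⦋n⦌) ⟶ T}
    (hg : simplicialLatchingMap (fibrewiseCoproduct S F) n ≫ g = 0)
    {x : S _⦋n⦌} (hx : x ∈ S.degenerate n) : fibrewiseι F x ≫ g = 0 := by
  obtain ⟨m, hm, t, ht, z, rfl⟩ := (S.mem_degenerate_iff x).1 hx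
  have h0 : (fibrewiseCoproduct S F).map t.op ≫ g = 0 := by
    have h := latchingι_comp_map (𝟭 SimplexCategoryᵒᵖ) (fibrewiseCoproduct S F) (op ⦋n⦌)
      (Over.mk t.op) ⟨ht, hm⟩
    have h' : (fibrewiseCoproduct S F).map t.op = _ := h.symm
    rw [h']
    exact (Category.assoc _ _ _).trans (by rw [hg, comp_zero])
  have h := fibrewiseι_comp_map F t z
  have := hF (CategoryOfElements.homMk (S.elementsMk _ z) (S.elementsMk _ (S.map t.op z)) t.op rfl)
    ht
  rw [← cancel_epi (F.map (CategoryOfElements.homMk (S.elementsMk _ z)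
    (S.elementsMk _ (S.map t.op z)) t.op rfl)), ← Category.assoc, ← h, Category.assoc, h0,
    comp_zero, comp_zero]

/-- The quotient of the fibrewise coproduct by its degenerate part is the coproduct over the
nondegenerate simplices. -/
noncomputable def cokernelLatchingIso (hF : InvertsDegeneracies S F) (n : ℕ) :
    cokernel (simplicialLatchingMap (fibrewiseCoproduct S F) n) ≅ nonDegenerateCoproduct F n where
  hom := cokernel.desc _ (toNonDegenerate F n) (latchingMap_comp_toNonDegenerate F n)
  inv := Limits.Sigma.desc fun x => fibrewiseι F x.1 ≫ cokernel.π _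
  hom_inv_id := by
    rw [← cancel_epi (cokernel.π _), cokernel.π_desc_assoc, Category.comp_id]
    refine fibrewise_hom_ext F fun x => ?_
    rw [← Category.assoc]
    by_cases hx : x ∈ S.degenerate n
    · rw [fibrewiseι_toNonDegenerate_eq_zero F hx, zero_comp,
        fibrewiseι_comp_eq_zero hF (cokernel.condition _) hx]
    · rw [fibrewiseι_toNonDegenerate F ⟨x, hx⟩]
      exact Limits.Sigma.ι_desc _ _
  inv_hom_id := by
    refine Limits.Sigma.hom_ext _ _ fun x => ?_
    rw [Limits.Sigma.ι_desc_assoc, Category.assoc, cokernel.π_desc, fibrewiseι_toNonDegenerate,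
      Category.comp_id]

end Normalized

/-! ### Lengths of degenerate and nondegenerate tuples -/

section Lengths

variable {X : Type u}

lemma ne_succ_of_mem_nonDegenerate {n : ℕ} {x : Fin (n + 1) → X}
    (hx : x ∈ (chaoticNerve X).nonDegenerate n) (i : Fin n) : x i.castSucc ≠ x i.succ := by
  intro h
  cases n with
  | zero => exact i.elim0
  | succ n =>
    refine hx ⟨n, Nat.lt_succ_self n, SimplexCategory.σ i, x ∘ i.castSucc.succAbove, ?_⟩
    funext j
    change x (i.castSucc.succAbove (i.predAbove j)) = x j
    -- Deleting and then repeating an entry changes the index only here, replacing `i.castSucc` by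
    -- `i.succ`; `h` says the points agree.
    by_cases hj : j = i.castSucc
    · subst hj
      rw [Fin.predAbove_castSucc_self, Fin.succAbove_castSucc_self, h]
    · rw [Fin.succAbove_predAbove hj]

variable [QuasiPseudoMetric X]

/-- `x` is in turn a pullback of `x ∘ α` along the section `β`, so `length_comp_le` applies in both
directions. -/
lemma length_comp_eq {m n : ℕ} (x : Fin (n + 1) → X) (α : Fin (m + 1) →o Fin (n + 1))
    (β : Fin (n + 1) →o Fin (m + 1)) (h : ∀ i, α (β i) = i) : length (x ∘ α) = length x := by
  refine le_antisymm (length_comp_le x α) ?_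
  have hx : x = (x ∘ α) ∘ β := funext fun i => congrArg x (h i).symm
  conv_lhs => rw [hx]
  exact length_comp_le (x ∘ α) β

lemma length_eq_of_epi {e e' : (chaoticNerve X).Elements} (φ : e ⟶ e') (h : Epi φ.val.unop) :
    length (X := X) (n := e.1.unop.len) e.2 = length (X := X) (n := e'.1.unop.len) e'.2 := by
  obtain ⟨⟨s⟩⟩ := isSplitEpi_of_epi φ.val.unop
  rw [← φ.property]
  exact (length_comp_eq (X := X) e.2 φ.val.unop.toOrderHom s.section_.toOrderHom
    fun i => SimplexCategory.congr_toOrderHom_apply s.id i).symm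

lemma invertsDegeneracies_barSummand (ℓ : ℝ) :
    InvertsDegeneracies (chaoticNerve X) (barSummand X ⋙ GradedObject.eval ℓ) := by
  intro e e' φ h
  -- `stabilization` kills maps between distinct lengths; equality selects its `eqToHom` branch.
  have hl : (lengthFunctor X).obj e = (lengthFunctor X).obj e' :=
    congrArg op (length_eq_of_epi φ h)
  have : (barSummand X ⋙ GradedObject.eval ℓ).map φ =
      eqToHom (by dsimp [barSummand]; rw [hl]) := dif_pos hl
  rw [this]
  infer_instance

variable [Finite X]

lemma exists_pos_le_d (hX : IsQuasiMetric X) :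
    ∃ δ : ℝ≥0, 0 < δ ∧ ∀ x y : X, x ≠ y → δ ≤ d x y := by
  -- Working with all small `δ` avoids a minimum over a possibly empty set of pairs.
  have h : ∀ᶠ δ in 𝓝[>] (0 : ℝ≥0), ∀ p : X × X, p.1 ≠ p.2 → δ ≤ d p.1 p.2 := by
    refine eventually_all.2 fun p => ?_
    by_cases hp : p.1 = p.2
    · simp [hp]
    · filter_upwards [mem_nhdsWithin_of_mem_nhds (Iio_mem_nhds (hX _ _ hp))] with δ hδ _
      exact le_of_lt hδ
  obtain ⟨δ, hδ, hpos⟩ := (h.and self_mem_nhdsWithin).exists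
  exact ⟨δ, hpos, fun x y hxy => hδ (x, y) hxy⟩

/-- Each of the `n` steps has length at least `δ`, so any `N > r / δ` serves. -/
lemma exists_lt_length (hX : IsQuasiMetric X) (r : ℝ) :
    ∃ N, ∀ n, N ≤ n → ∀ x : Fin (n + 1) → X, x ∈ (chaoticNerve X).nonDegenerate n →
      r < length x := by
  obtain ⟨δ, hδ, hd⟩ := exists_pos_le_d hX
  obtain ⟨N, hN⟩ := exists_nat_gt (r / δ)
  refine ⟨N, fun n hn x hx => ?_⟩
  have h1 : n • δ ≤ length x := by
    simpa [length] using Finset.card_nsmul_le_sum Finset.univ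
      (fun i : Fin n => d (x i.castSucc) (x i.succ))
      δ fun i _ => hd _ _ (ne_succ_of_mem_nonDegenerate hx i)
  have h2 : (n : ℝ) * δ ≤ length x := by exact_mod_cast (nsmul_eq_mul n δ) ▸ h1
  have hδ' : (0 : ℝ) < δ := hδ
  rw [div_lt_iff₀ hδ'] at hN
  have hn' : (N : ℝ) ≤ n := by exact_mod_cast hn
  nlinarith

end Lengths

/-! ### Ranks and Hahn finiteness -/

section Ranks

lemma stabilization_obj_of_eq {ℓ : ℝ≥0ᵒᵖ} {k : ℝ} (h : (ℓ.unop : ℝ) = k) :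
    stabilization.{u}.obj ℓ k = ModuleCat.of ℤ (ULift.{u} ℤ) :=
  if_pos h

lemma stabilization_obj_of_ne {ℓ : ℝ≥0ᵒᵖ} {k : ℝ} (h : (ℓ.unop : ℝ) ≠ k) :
    stabilization.{u}.obj ℓ k = ModuleCat.of ℤ PUnit.{u + 1} :=
  if_neg h

lemma stabilization_obj_free (ℓ : ℝ≥0ᵒᵖ) (k : ℝ) :
    Module.Free ℤ (stabilization.{u}.obj ℓ k) ∧ Module.Finite ℤ (stabilization.{u}.obj ℓ k) := by
  by_cases h : (ℓ.unop : ℝ) = k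
  · rw [stabilization_obj_of_eq h]
    exact ⟨inferInstanceAs (Module.Free ℤ (ULift.{u} ℤ)),
      inferInstanceAs (Module.Finite ℤ (ULift.{u} ℤ))⟩
  · rw [stabilization_obj_of_ne h]
    exact ⟨inferInstanceAs (Module.Free ℤ PUnit.{u + 1}),
      inferInstanceAs (Module.Finite ℤ PUnit.{u + 1})⟩

open Classical in
lemma finrank_stabilization_obj (ℓ : ℝ≥0ᵒᵖ) (k : ℝ) :
    Module.finrank ℤ (stabilization.{u}.obj ℓ k) = if (ℓ.unop : ℝ) = k then 1 else 0 := by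
  split_ifs with h
  · rw [stabilization_obj_of_eq h]
    exact (ULift.moduleEquiv (R := ℤ) (M := ℤ)).finrank_eq.trans (Module.finrank_self ℤ)
  · rw [stabilization_obj_of_ne h]
    exact Module.finrank_zero_of_subsingleton (R := ℤ) (M := PUnit.{u + 1})

lemma isFiniteComplex_of_free (C : ChainComplex (ModuleCat.{u} ℤ) ℕ)
    (hC : ∀ n, Module.Free ℤ (C.X n) ∧ Module.Finite ℤ (C.X n)) {N : ℕ}
    (hN : ∀ n, N ≤ n → Module.finrank ℤ (C.X n) = 0) : IsFiniteComplex C := by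
  refine ⟨C, 𝟙 C, hC, ⟨N, fun n hn => ?_⟩, inferInstance⟩
  obtain ⟨_, _⟩ := hC n
  have := (Module.finrank_eq_zero_iff_of_free ℤ (C.X n)).1 (hN n hn)
  exact ModuleCat.isZero_of_subsingleton _

/-- Well-orderedness of the support is inherited from the Hahn series `s`. -/
lemma isHahnFinite_of_coeff {C : GradedObject ℝ (ChainComplex (ModuleCat.{u} ℤ) ℕ)}
    (hC : ∀ ℓ, IsFiniteComplex (C ℓ)) {s : HahnSeries ℝ ℚ}
    (hs : ∀ ℓ, ((C ℓ).homologyEulerChar : ℚ) = s.coeff ℓ) :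
    IsHahnFinite C ∧ hahnEulerChar C = s := by
  have h : IsHahnFinite C := ⟨hC, by simpa only [hs] using s.isPWO_support'⟩
  refine ⟨h, ?_⟩
  rw [hahnEulerChar, dif_pos h]
  ext ℓ
  exact hs ℓ

lemma isHahnFinite_inDegreeZero {M : GradedObject ℝ (ModuleCat.{u} ℤ)}
    (hM : ∀ ℓ, Module.Free ℤ (M ℓ) ∧ Module.Finite ℤ (M ℓ)) {s : HahnSeries ℝ ℚ}
    (hs : ∀ ℓ, (Module.finrank ℤ (M ℓ) : ℚ) = s.coeff ℓ) :
    IsHahnFinite (inDegreeZero M) ∧ hahnEulerChar (inDegreeZero M) = s := by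
  have hsucc (ℓ : ℝ) (n : ℕ) : Subsingleton ((inDegreeZero M ℓ).X (n + 1)) :=
    ModuleCat.subsingleton_of_isZero (HomologicalComplex.isZero_single_obj_X _ _ _ _ (by simp))
  have hfree (ℓ : ℝ) (n : ℕ) : Module.Free ℤ ((inDegreeZero M ℓ).X n) ∧
      Module.Finite ℤ ((inDegreeZero M ℓ).X n) := by
    cases n with
    | zero => exact hM ℓ
    | succ n =>
      have := hsucc ℓ n
      exact ⟨inferInstance, inferInstance⟩
  have hN (ℓ : ℝ) (n : ℕ) (hn : 1 ≤ n) : Module.finrank ℤ ((inDegreeZero M ℓ).X n) = 0 := by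
    obtain ⟨n, rfl⟩ := Nat.exists_eq_add_of_le' hn
    have := hsucc ℓ n
    exact Module.finrank_zero_of_subsingleton
  refine isHahnFinite_of_coeff (fun ℓ => isFiniteComplex_of_free _ (hfree ℓ) (hN ℓ)) fun ℓ => ?_
  have := fun n => (hfree ℓ n).2
  rw [homologyEulerChar_eq_sum _ (hN ℓ), ← hs]
  simp
  rfl

end Ranks

/-! ### Ranks of finite coproducts -/

section Coproducts

variable {R : Type*} [CommRing R] {ι : Type u} {Z : ι → ModuleCat.{u} R}

lemma free_and_finite_sigma [Finite ι]
    (hZ : ∀ i, Module.Free R (Z i) ∧ Module.Finite R (Z i)) :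
    Module.Free R (∐ Z : ModuleCat.{u} R) ∧ Module.Finite R (∐ Z : ModuleCat.{u} R) := by
  classical
  have h1 (i : ι) := (hZ i).1
  have h2 (i : ι) := (hZ i).2
  exact ⟨Module.Free.of_equiv (ModuleCat.coprodIsoDirectSum Z).toLinearEquiv.symm,
    Module.Finite.equiv (ModuleCat.coprodIsoDirectSum Z).toLinearEquiv.symm⟩

lemma finrank_sigma [Nontrivial R] [Fintype ι]
    (hZ : ∀ i, Module.Free R (Z i) ∧ Module.Finite R (Z i)) :
    Module.finrank R (∐ Z : ModuleCat.{u} R) = ∑ i, Module.finrank R (Z i) := by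
  classical
  have h1 (i : ι) := (hZ i).1
  have h2 (i : ι) := (hZ i).2
  rw [(ModuleCat.coprodIsoDirectSum Z).toLinearEquiv.finrank_eq]
  exact Module.finrank_directSum R fun i => Z i

end Coproducts

/-! ### Weights of tuples -/

section TupleWeights

variable {X : Type u} [QuasiPseudoMetric X]

lemma barSummand_obj_free (e : (chaoticNerve X).Elements) (ℓ : ℝ) :
    Module.Free ℤ ((barSummand X).obj e ℓ) ∧ Module.Finite ℤ ((barSummand X).obj e ℓ) :=
  stabilization_obj_free _ _

open Classical in
lemma finrank_barSummand_obj {n : ℕ} (x : Fin (n + 1) → X) (ℓ : ℝ) :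
    Module.finrank ℤ ((barSummand X).obj (tuple x) ℓ) = if (length x : ℝ) = ℓ then 1 else 0 :=
  finrank_stabilization_obj _ _

open Classical in
lemma finrank_barSummand_obj_eq_coeff {n : ℕ} (x : Fin (n + 1) → X) (ℓ : ℝ) :
    (Module.finrank ℤ ((barSummand X).obj (tuple x) ℓ) : ℚ) =
      (HahnSeries.single (length x : ℝ) (1 : ℚ)).coeff ℓ := by
  rw [finrank_barSummand_obj, HahnSeries.coeff_single]
  simp [eq_comm]

lemma isHahnFinite_tupleObj {n : ℕ} (x : Fin (n + 1) → X) : IsHahnFinite (tupleObj x) ∧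
    hahnEulerChar (tupleObj x) = HahnSeries.single (length x : ℝ) (1 : ℚ) :=
  isHahnFinite_inDegreeZero (barSummand_obj_free _) (finrank_barSummand_obj_eq_coeff x)

lemma isHahnFinite_tupleLatching_of_degenerate {n : ℕ} {x : Fin (n + 1) → X}
    (hx : x ∈ (chaoticNerve X).degenerate n) : IsHahnFinite (tupleLatching x) ∧
      hahnEulerChar (tupleLatching x) = HahnSeries.single (length x : ℝ) (1 : ℚ) := by
  let e (ℓ : ℝ) := (@asIso _ _ _ _
    (latchingMap _ (barSummand X ⋙ GradedObject.eval ℓ) (tuple x))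
    (isIso_latchingMap (invertsDegeneracies_barSummand (X := X) ℓ) hx)).toLinearEquiv
  refine isHahnFinite_inDegreeZero (fun ℓ => ?_) fun ℓ => ?_
  · have : Module.Free ℤ ((barSummand X ⋙ GradedObject.eval ℓ).obj (tuple x)) :=
      (barSummand_obj_free _ ℓ).1
    have : Module.Finite ℤ ((barSummand X ⋙ GradedObject.eval ℓ).obj (tuple x)) :=
      (barSummand_obj_free _ ℓ).2
    exact ⟨Module.Free.of_equiv (e ℓ).symm, Module.Finite.equiv (e ℓ).symm⟩
  · rw [← finrank_barSummand_obj_eq_coeff x]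
    exact congrArg Nat.cast (e ℓ).finrank_eq

lemma isHahnFinite_tupleLatching_of_nonDegenerate {n : ℕ} {x : Fin (n + 1) → X}
    (hx : x ∈ (chaoticNerve X).nonDegenerate n) : IsHahnFinite (tupleLatching x) ∧
      hahnEulerChar (tupleLatching x) = 0 := by
  have h (ℓ : ℝ) : Subsingleton (latchingObj (CategoryOfElements.π (chaoticNerve X))
      (barSummand X ⋙ GradedObject.eval ℓ) (tuple x) : ModuleCat.{u} ℤ) :=
    ModuleCat.subsingleton_of_isZero ((isZero_zero _).of_iso
      ((latchingObjIsInitial hx).uniqueUpToIso HasZeroObject.zeroIsInitial))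
  exact isHahnFinite_inDegreeZero (fun ℓ => ⟨inferInstance, inferInstance⟩) fun ℓ => by
    simp [Module.finrank_zero_of_subsingleton]

lemma isHahnFinite_tupleLatching {n : ℕ} (x : Fin (n + 1) → X) :
    IsHahnFinite (tupleLatching x) := by
  by_cases hx : x ∈ (chaoticNerve X).degenerate n
  · exact (isHahnFinite_tupleLatching_of_degenerate hx).1
  · exact (isHahnFinite_tupleLatching_of_nonDegenerate hx).1

open Classical in
/-- The weight of a tuple is `q ^ length` if consecutive points are distinct, and `0` otherwise. -/
lemma weight_eq {n : ℕ} (x : Fin (n + 1) → X) :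
    weight x = if x ∈ (chaoticNerve X).nonDegenerate n then
      HahnSeries.single (length x : ℝ) (1 : ℚ) else 0 := by
  rw [weight, (isHahnFinite_tupleObj x).2]
  split_ifs with hx
  · rw [(isHahnFinite_tupleLatching_of_nonDegenerate hx).2, sub_zero]
  · rw [(isHahnFinite_tupleLatching_of_degenerate (not_not.1 hx)).2, sub_self]

open Classical in
lemma coeff_weight {n : ℕ} (x : Fin (n + 1) → X) (ℓ : ℝ) :
    (weight x).coeff ℓ = if x ∈ (chaoticNerve X).nonDegenerate n ∧ (length x : ℝ) = ℓ
      then 1 else 0 := by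
  rw [weight_eq]
  by_cases hx : x ∈ (chaoticNerve X).nonDegenerate n
  · simp [hx, HahnSeries.coeff_single, eq_comm]
  · simp [hx]

lemma coeff_neg_one_pow_mul (n : ℕ) (s : HahnSeries ℝ ℚ) (ℓ : ℝ) :
    ((-1) ^ n * s).coeff ℓ = (-1) ^ n * s.coeff ℓ := by
  rcases n.even_or_odd with h | h <;> simp [h.neg_one_pow]

end TupleWeights

/-! ### Chains of the realized nerve -/

section Nerve

variable {X : Type u} [QuasiPseudoMetric X]

/-- The chains of the realized magnitude nerve are the coproduct of the summands of the tuples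
without consecutive repetitions. -/
noncomputable def realizedNerveXIso (ℓ : ℝ) (n : ℕ) : (realizedMagnitudeNerve X ℓ).X n ≅
    nonDegenerateCoproduct (S := chaoticNerve X) (barSummand X ⋙ GradedObject.eval ℓ) n :=
  cokernelLatchingIso (invertsDegeneracies_barSummand (X := X) ℓ) n

variable [Fintype X]

lemma realizedNerve_X_free (ℓ : ℝ) (n : ℕ) :
    Module.Free ℤ ((realizedMagnitudeNerve X ℓ).X n) ∧
      Module.Finite ℤ ((realizedMagnitudeNerve X ℓ).X n) := by
  have : Finite ((chaoticNerve X) _⦋n⦌) := inferInstanceAs (Finite (Fin (n + 1) → X))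
  obtain ⟨_, _⟩ := free_and_finite_sigma (ι := (chaoticNerve X).nonDegenerate n)
    (Z := fun x => (barSummand X ⋙ GradedObject.eval ℓ).obj
      ((chaoticNerve X).elementsMk (op ⦋n⦌) x.1)) fun x => barSummand_obj_free _ ℓ
  exact ⟨Module.Free.of_equiv (realizedNerveXIso ℓ n).toLinearEquiv.symm,
    Module.Finite.equiv (realizedNerveXIso ℓ n).toLinearEquiv.symm⟩

lemma finrank_realizedNerve_X (ℓ : ℝ) (n : ℕ) :
    (Module.finrank ℤ ((realizedMagnitudeNerve X ℓ).X n) : ℚ) =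
      (∑ x : Fin (n + 1) → X, weight x).coeff ℓ := by
  classical
  let p : (Fin (n + 1) → X) → Prop := fun x => x ∈ (chaoticNerve X).nonDegenerate n
  let _ : Fintype ((chaoticNerve X).nonDegenerate n) := Subtype.fintype p
  have h := (realizedNerveXIso (X := X) ℓ n).toLinearEquiv.finrank_eq.trans
    (finrank_sigma fun x => barSummand_obj_free _ ℓ)
  rw [h, HahnSeries.coeff_sum]
  push_cast
  -- Degenerate tuples have weight zero, so only the index set of the chains remains.
  have h1 : ∑ x : Fin (n + 1) → X, (weight x).coeff ℓ =
      ∑ x : Subtype p, (if (length x.1 : ℝ) = ℓ then 1 else 0 : ℚ) := by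
    rw [← Finset.sum_subtype (Finset.univ.filter p) (by simp [p])
      (fun x => (if (length x : ℝ) = ℓ then 1 else 0 : ℚ)), Finset.sum_filter]
    refine Finset.sum_congr rfl fun x _ => ?_
    rw [coeff_weight, ite_and]
  rw [h1]
  refine Finset.sum_congr rfl fun x _ => ?_
  exact (congrArg Nat.cast (finrank_barSummand_obj (X := X) (n := n) x.1 ℓ)).trans (by simp)

end Nerve

/-! ### Convergence of the weight series -/

section Convergence

variable {X : Type u} [QuasiPseudoMetric X]

/-- The sets `T n` are arbitrary so that both fixed endpoints and all tuples are covered. -/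
lemma exists_tendsto_sum_weight [Finite X] (hX : IsQuasiMetric X)
    (T : ∀ n : ℕ, Finset (Fin (n + 1) → X)) :
    ∃ s : HahnSeries ℝ ℚ, (∀ ℓ, s.coeff ℓ = ∑ᶠ n, ((-1) ^ n * ∑ x ∈ T n, weight x).coeff ℓ) ∧
      Tendsto (fun N : ℕ => ∑ n ∈ Finset.range N, (-1) ^ n * ∑ x ∈ T n, weight x)
        atTop (𝓝 s) := by
  classical
  refine exists_tendsto_sum_hahnSeries (fun r => ?_) fun n => ?_
  · obtain ⟨N, hN⟩ := exists_lt_length hX r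
    refine ⟨N, fun n hn k hk => ?_⟩
    rw [coeff_neg_one_pow_mul, HahnSeries.coeff_sum, Finset.sum_eq_zero, mul_zero]
    intro x _
    rw [coeff_weight, if_neg]
    rintro ⟨hx, rfl⟩
    exact absurd (hN n hn x hx) (not_lt.2 hk)
  · refine ((T n).image fun x => (length x : ℝ)).finite_toSet.subset fun ℓ hℓ => ?_
    rw [HahnSeries.mem_support, coeff_neg_one_pow_mul, HahnSeries.coeff_sum] at hℓ
    obtain ⟨x, hx, hne⟩ := Finset.exists_ne_zero_of_sum_ne_zero (right_ne_zero_of_mul hℓ)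
    rw [coeff_weight] at hne
    have h := (ite_ne_right_iff.1 hne).1.2
    exact Finset.mem_coe.2 (Finset.mem_image.2 ⟨x, hx, h⟩)

/-- The complex is bounded grading by grading, with a bound depending on `ℓ`; there Euler–Poincaré
turns chain ranks into the coefficients of `s`. -/
lemma isHahnFinite_realizedMagnitudeNerve [Fintype X]
    (hX : IsQuasiMetric X) {s : HahnSeries ℝ ℚ}
    (hs : ∀ ℓ, s.coeff ℓ = ∑ᶠ n, ((-1) ^ n * ∑ x : Fin (n + 1) → X, weight x).coeff ℓ) :
    IsHahnFinite (realizedMagnitudeNerve X) ∧ hahnEulerChar (realizedMagnitudeNerve X) = s := by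
  have h (ℓ : ℝ) : ∃ N, ∀ n, N ≤ n →
      Module.finrank ℤ ((realizedMagnitudeNerve X ℓ).X n) = 0 := by
    obtain ⟨N, hN⟩ := exists_lt_length hX ℓ
    refine ⟨N, fun n hn => ?_⟩
    have := finrank_realizedNerve_X (X := X) ℓ n
    rw [HahnSeries.coeff_sum, Finset.sum_eq_zero] at this
    · exact_mod_cast this
    · intro x _
      classical
      rw [coeff_weight, if_neg]
      rintro ⟨hx, rfl⟩
      exact lt_irrefl _ (hN n hn x hx)
  choose N hN using h
  refine isHahnFinite_of_coeff
    (fun ℓ => isFiniteComplex_of_free _ (realizedNerve_X_free ℓ) (hN ℓ)) fun ℓ => ?_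
  have := fun n => (realizedNerve_X_free (X := X) ℓ n).2
  rw [homologyEulerChar_eq_sum _ (hN ℓ), hs,
    finsum_eq_sum_of_support_subset (s := Finset.range (N ℓ))]
  · push_cast
    refine Finset.sum_congr rfl fun n _ => ?_
    rw [coeff_neg_one_pow_mul, finrank_realizedNerve_X]
  · intro n hn
    by_contra hlt
    rw [Function.mem_support, coeff_neg_one_pow_mul, ← finrank_realizedNerve_X,
      hN ℓ n (by simpa using hlt)] at hn
    simp at hn

end Convergence

end MagnitudeHomology

theorem mainTheorem11 {X : Type u} [Fintype X] [MagnitudeHomology.QuasiPseudoMetric X]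
    (hX : MagnitudeHomology.IsQuasiMetric X) :
    MagnitudeHomology.HasConvergentMagnitudeEulerChar X := by
  obtain ⟨s, hs, hlim⟩ := MagnitudeHomology.exists_tendsto_sum_weight hX fun _ => Finset.univ
  obtain ⟨hfin, hchi⟩ := MagnitudeHomology.isHahnFinite_realizedMagnitudeNerve hX hs
  refine ⟨fun n x => (MagnitudeHomology.isHahnFinite_tupleObj x).1,
    fun n x => MagnitudeHomology.isHahnFinite_tupleLatching x, hfin, fun a b => ?_, ?_⟩
  · obtain ⟨t, -, ht⟩ := MagnitudeHomology.exists_tendsto_sum_weight hX fun n =>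
      open Classical in Finset.univ.filter fun x : Fin (n + 1) → X => x 0 = a ∧ x (Fin.last n) = b
    exact ⟨t, ht⟩
  · rw [hchi]
    exact hlim
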